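/- For $\xi\in\mathbb{R}$ let $\mu(\xi)\in[1,\infty]$ be the irrationality exponent of $\xi$, that is the supremum of all $\mu$ for which $|\xi-p/q|\le q^{-\mu}$ holds for infinitely many rational numbers $p/q$ (in lowest terms, $q\geq 1$). For $\lambda\in[2,\infty]$ let $\mathscr{W}_{\lambda}=\{\xi\in\mathbb{R}:\mu(\xi)=\lambda\}$; in particular $\mathscr{W}_\infty$ is the set of Liouville numbers. Let $\dim$ and $\dim_P$ denote Hausdorff and packing dimension of subsets of the Euclidean plane $\mathbb{R}^2$. Then \[ \lim_{\min\{\lambda_0,\lambda_1\}\to\infty}\dim(\mathscr{W}_{\lambda_0}\times\mathscr{W}_{\lambda_1})=1, \qquad \lim_{\min\{\lambda_0,\lambda_1\}\to\infty}\dim_P(\mathscr{W}_{\lambda_0}\times\mathscr{W}_{\lambda_1})=2, \] where the limits are taken over all points $(\lambda_0,\lambda_1)\in[2,\infty]^2$ (the value $\infty$ being allowed) whose minimum tends to infinity: for every $\varepsilon>0$ there is a real $M$ such that $|\dim(\mathscr{W}_{\lambda_0}\times\mathscr{W}_{\lambda_1})-1|<\varepsilon$ and $|\dim_P(\mathscr{W}_{\lambda_0}\times\mathscr{W}_{\lambda_1})-2|<\varepsilon$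 for all $\lambda_0,\lambda_1\in[M,\infty]$. -/

import Mathlib

open scoped ENNReal NNReal

/-- The irrationality exponent of a real number `ξ`: the supremum (in `[0, ∞]`) of the exponents `ν`
for which `|ξ - p / q| ≤ q ^ (-ν)` holds for infinitely many rational numbers `p / q`.
Rational numbers are written in lowest terms; this is the weakest condition on a given rational
number. The exponent `ν = 1` is always admissible, so that restricting to `ν ≥ 0` changes
nothing; the value is `1` for rational `ξ`. -/
noncomputable def irrationalityExponent (ξ : ℝ) : ℝ≥0∞ :=
  ⨆ (ν : ℝ≥0) (_ : {r : ℚ | |ξ - (r : ℝ)| ≤ (r.den : ℝ) ^ (-(ν : ℝ))}.Infinite), (ν : ℝ≥0∞)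

/-- The set `W_l` of real numbers with irrationality exponent equal to `l`; `W_∞` is the set of
Liouville numbers. -/
def exactOrderSet (l : ℝ≥0∞) : Set ℝ :=
  {ξ : ℝ | irrationalityExponent ξ = l}

/-- The Cartesian product `A × B` of two sets of real numbers as a subset of the Euclidean plane. -/
def planarProduct (A B : Set ℝ) : Set (EuclideanSpace ℝ (Fin 2)) :=
  {x | x 0 ∈ A ∧ x 1 ∈ B}

section Packing

variable {X : Type*} [MetricSpace X]

/-- `t` is a finite `δ`-packing of `A`: a finite family of pairwise disjoint closed balls with
centres in `A` and positive radii at most `δ`. A ball is given by a pair (centre, radius). -/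
def IsFinitePacking (δ : ℝ) (A : Set X) (t : Finset (X × ℝ)) : Prop :=
  (∀ b ∈ t, b.1 ∈ A ∧ 0 < b.2 ∧ b.2 ≤ δ) ∧
    (t : Set (X × ℝ)).PairwiseDisjoint (fun b => Metric.closedBall b.1 b.2)

/-- The supremum of the sums `∑ (2 r_i) ^ s` over all `δ`-packings of `A` by balls of radii `r_i`
(in Euclidean space `2 r_i` is the diameter). It is enough to use finite packings, since a countable
sum of non-negative terms is the supremum of its finite partial sums. -/
noncomputable def packingSup (s : ℝ≥0) (δ : ℝ) (A : Set X) : ℝ≥0∞ :=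
  ⨆ (t : Finset (X × ℝ)) (_ : IsFinitePacking δ A t),
    ∑ b ∈ t, ENNReal.ofReal (2 * b.2) ^ (s : ℝ)

/-- The `s`-dimensional packing premeasure: the (decreasing) limit of `packingSup s δ A` as
`δ → 0`. -/
noncomputable def packingPremeasure (s : ℝ≥0) (A : Set X) : ℝ≥0∞ :=
  ⨅ (δ : ℝ) (_ : 0 < δ), packingSup s δ A

/-- The `s`-dimensional packing measure: the infimum of `∑ packingPremeasure s (C i)` over all
countable covers `(C i)` of `A`. -/
noncomputable def packingMeasure (s : ℝ≥0) (A : Set X) : ℝ≥0∞ :=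
  ⨅ (C : ℕ → Set X) (_ : A ⊆ ⋃ i, C i), ∑' i, packingPremeasure s (C i)

/-- The packing dimension: the supremum of the `s` for which the `s`-dimensional packing measure is
infinite. -/
noncomputable def dimPacking (A : Set X) : ℝ≥0∞ :=
  ⨆ (s : ℝ≥0) (_ : packingMeasure s A = ∞), (s : ℝ≥0∞)

end Packing

/-! Upper bounds. If the first coordinate has exponent above `n`, it lies within `q ^ (-n)` of
infinitely many `p / q`. Splitting the other axis at scale `q ^ (-n)` covers a bounded part of the
product by about `q * q ^ n` squares of that size for each `q`. Hausdorff–Cantelli then gives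
dimension at most `1 + 3 / n`, whatever the second factor is. Packing dimension in the plane never
exceeds `2`.

Lower bounds, valid once both exponents are at least `8`. In each coordinate, prescribe binary
digits `1 0 … 0 1` on sparse long blocks `[s k, e k]` with `e k / (s k + 1)` tending to the
exponent, and toss fair coins elsewhere. Cutting at a block start gives dyadic approximations that
force the exponent to be at least the target. Any other good approximation is either excluded by the
spacing of fractions (`eq_truncation`) or has a denominator for which most relevant digits are
random, and Borel–Cantelli removes it almost surely (`ae_irrationalityExponent_eq`).

The blocks of the two coordinates are interleaved, hence disjoint. So at every scale `2 ^ (-m)` at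
least `m` of the `2 * m` digits are random, and the mass distribution principle gives Hausdorff
dimension at least `1`. Before each new pair of blocks there is a very long stretch free in both
coordinates. At these special scales almost all `2 * m` digits are random, and infinitely many good
scales suffice for packing dimension `2`. -/

open MeasureTheory Filter Topology Metric

/-! ### Packing measure: lower bounds from a mass distribution -/

section PackingLower

variable {X : Type*} [MetricSpace X]

theorem sum_le_packingSup {s : ℝ≥0} {δ : ℝ} {A : Set X} {t : Finset (X × ℝ)}
    (ht : IsFinitePacking δ A t) :
    ∑ b ∈ t, ENNReal.ofReal (2 * b.2) ^ (s : ℝ) ≤ packingSup s δ A :=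
  le_iSup₂_of_le t ht le_rfl

theorem card_mul_le_packingSup {s : ℝ≥0} {δ r : ℝ} {A : Set X} (hr : 0 < r) (hrδ : r ≤ δ)
    {t : Finset X} (htA : ∀ x ∈ t, x ∈ A)
    (hsep : (t : Set X).Pairwise fun x y => 2 * r < dist x y) :
    ∑ _x ∈ t, ENNReal.ofReal (2 * r) ^ (s : ℝ) ≤ packingSup s δ A := by
  classical
  have hinj : Function.Injective fun x : X => (x, r) := fun x y h => (Prod.ext_iff.1 h).1
  have h := sum_le_packingSup (s := s) (δ := δ) (A := A) (t := t.map ⟨_, hinj⟩) ⟨by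
    intro b hb
    obtain ⟨x, hx, rfl⟩ := Finset.mem_map.1 hb
    exact ⟨htA x hx, hr, hrδ⟩, by
    intro b hb c hc hbc
    obtain ⟨x, hx, rfl⟩ := Finset.mem_map.1 (Finset.mem_coe.1 hb)
    obtain ⟨y, hy, rfl⟩ := Finset.mem_map.1 (Finset.mem_coe.1 hc)
    have hxy : x ≠ y := fun h => hbc (by simp [h])
    refine Metric.closedBall_disjoint_closedBall ?_
    have := hsep hx hy hxy
    simp only [Function.Embedding.coeFn_mk]
    linarith⟩
  simpa [Finset.sum_map] using h

/-- A maximal `2 r`-separated subset of `C` gives a packing that controls the measure of `C`. -/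
theorem measure_le_mul_packingSup [SecondCountableTopology X] [MeasurableSpace X]
    (μ : Measure X) {s : ℝ≥0} {δ r : ℝ} {κ : ℝ≥0∞} (hr : 0 < r) (hrδ : r ≤ δ) (C : Set X)
    (hμ : ∀ x, μ (closedBall x (2 * r)) ≤ κ * ENNReal.ofReal (2 * r) ^ (s : ℝ)) :
    μ C ≤ κ * packingSup s δ C := by
  obtain ⟨T, hT⟩ : ∃ T, Maximal (fun T : Set X => T ⊆ C ∧
      T.Pairwise fun x y => 2 * r < dist x y) T := by
    refine zorn_subset _ fun c hc hchain => ⟨⋃₀ c, ⟨Set.sUnion_subset fun t ht => (hc ht).1, ?_⟩,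
      fun t ht => Set.subset_sUnion_of_mem ht⟩
    exact (Set.pairwise_sUnion hchain.directedOn).2 fun t ht => (hc ht).2
  have hTc : T.Countable := by
    refine Set.PairwiseDisjoint.countable_of_isOpen (s := fun x => ball x r) ?_
      (fun _ _ => isOpen_ball) (fun x _ => ⟨x, mem_ball_self hr⟩)
    intro x hx y hy hxy
    refine ball_disjoint_ball ?_
    have := hT.prop.2 hx hy hxy
    linarith
  have hcover : C ⊆ ⋃ x ∈ T, closedBall x (2 * r) := by
    intro y hy
    by_contra hcon
    simp only [Set.mem_iUnion, mem_closedBall, not_exists, not_le] at hcon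
    have hins : insert y T ⊆ T := hT.le_of_ge (y := insert y T)
      ⟨Set.insert_subset hy hT.prop.1, hT.prop.2.insert fun x hx _ =>
        ⟨hcon x hx, by rw [dist_comm]; exact hcon x hx⟩⟩ (Set.subset_insert _ _)
    have := hcon y (hins (Set.mem_insert _ _))
    rw [dist_self] at this
    linarith
  have := hTc.to_subtype
  calc μ C ≤ ∑' x : T, μ (closedBall (x : X) (2 * r)) :=
        (measure_mono hcover).trans (measure_biUnion_le μ hTc _)
    _ ≤ ∑' _x : T, κ * ENNReal.ofReal (2 * r) ^ (s : ℝ) := ENNReal.tsum_le_tsum fun x => hμ x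
    _ = κ * ∑' _x : T, ENNReal.ofReal (2 * r) ^ (s : ℝ) := ENNReal.tsum_mul_left
    _ ≤ κ * packingSup s δ C := by
        gcongr
        rw [ENNReal.tsum_eq_iSup_sum]
        refine iSup_le fun F => ?_
        have h := card_mul_le_packingSup (s := s) (A := C) (t := F.map (Function.Embedding.subtype _))
          hr hrδ
          (fun x hx => by
            obtain ⟨y, -, rfl⟩ := Finset.mem_map.1 hx
            exact hT.prop.1 y.2)
          (fun x hx y hy hxy => by
            obtain ⟨x', -, rfl⟩ := Finset.mem_map.1 (Finset.mem_coe.1 hx)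
            obtain ⟨y', -, rfl⟩ := Finset.mem_map.1 (Finset.mem_coe.1 hy)
            exact hT.prop.2 x'.2 y'.2 hxy)
        simpa [Finset.sum_map] using h

/-- Every countable cover has a piece of positive mass, and letting `κ` tend to `0` makes its
premeasure infinite. One good radius below each `δ` is enough, whereas Hausdorff measure would need
all small radii. -/
theorem packingMeasure_eq_top [SecondCountableTopology X] [MeasurableSpace X]
    (μ : Measure X) {s : ℝ≥0} {A : Set X} (hA : μ A ≠ 0)
    (hμ : ∀ κ : ℝ≥0∞, κ ≠ 0 → ∀ δ : ℝ, 0 < δ → ∃ r, 0 < r ∧ r ≤ δ ∧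
      ∀ x, μ (closedBall x (2 * r)) ≤ κ * ENNReal.ofReal (2 * r) ^ (s : ℝ)) :
    packingMeasure s A = ∞ := by
  refine iInf₂_eq_top.2 fun C hC => ?_
  obtain ⟨i, hi⟩ : ∃ i, μ (C i) ≠ 0 := by
    by_contra! h
    exact hA (measure_mono_null hC (measure_iUnion_null h))
  refine ENNReal.tsum_eq_top_of_eq_top ⟨i, iInf₂_eq_top.2 fun δ hδ => ?_⟩
  by_contra hP
  obtain ⟨κ, hκ, hlt⟩ : ∃ κ : ℝ≥0∞, κ ≠ 0 ∧ κ * packingSup s δ (C i) < μ (C i) := by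
    obtain ⟨κ, h0, h⟩ := ENNReal.exists_nnreal_pos_mul_lt hP hi
    exact ⟨κ, by exact_mod_cast h0.ne', h⟩
  obtain ⟨r, hr, hrδ, h⟩ := hμ κ hκ δ hδ
  exact hlt.not_ge (measure_le_mul_packingSup μ hr hrδ (C i) h)

end PackingLower

/-! ### Packing dimension is at most the dimension of the space -/

section PackingUpper

variable {E : Type*} [NormedAddCommGroup E] [NormedSpace ℝ E] [FiniteDimensional ℝ E]

/-- Comparing volumes of disjoint balls bounds the sum of the `n`-th powers of the diameters, `n`
being the dimension; the surplus exponent contributes a factor `(2 * δ) ^ (s - n)`, which tends to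
`0`. -/
theorem packingPremeasure_eq_zero_of_bounded {s : ℝ≥0} (hs : (Module.finrank ℝ E : ℝ) < s)
    {A : Set E} {R : ℝ} (hA : A ⊆ closedBall 0 R) : packingPremeasure s A = 0 := by
  borelize E
  set n := Module.finrank ℝ E with hn
  set vol : Measure E := Measure.addHaar
  set K : ℝ≥0∞ := 2 ^ n * vol (closedBall 0 (R + 1)) / vol (ball 0 1) with hK
  have hv0 : vol (ball 0 1) ≠ 0 := (measure_ball_pos _ _ one_pos).ne'
  have hvt : vol (ball 0 1) ≠ ∞ := measure_ball_lt_top.ne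
  have hKt : K ≠ ∞ := ENNReal.div_ne_top
    (ENNReal.mul_ne_top (by simp) measure_closedBall_lt_top.ne) hv0
  have key : ∀ δ : ℝ, 0 < δ → δ ≤ 1 →
      packingSup s δ A ≤ ENNReal.ofReal (2 * δ) ^ ((s : ℝ) - n) * K := by
    intro δ hδ hδ1
    refine iSup₂_le fun t ht => ?_
    have hdisj : ∑ b ∈ t, vol (closedBall b.1 b.2) ≤ vol (closedBall 0 (R + 1)) := by
      rw [← measure_biUnion_finset ht.2 fun _ _ => measurableSet_closedBall]
      refine measure_mono (Set.iUnion₂_subset fun b hb => ?_)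
      refine closedBall_subset_closedBall' ?_
      have h1 := ht.1 b hb
      have h2 : dist b.1 0 ≤ R := mem_closedBall.1 (hA h1.1)
      linarith [h1.2.2]
    have hpow : ∑ b ∈ t, ENNReal.ofReal (2 * b.2) ^ n ≤ K := by
      rw [hK, ENNReal.le_div_iff_mul_le (Or.inl hv0) (Or.inl hvt), Finset.sum_mul]
      refine le_trans (le_of_eq ?_) (mul_le_mul_right hdisj (2 ^ n))
      rw [Finset.mul_sum]
      refine Finset.sum_congr rfl fun b hb => ?_
      rw [Measure.addHaar_closedBall vol _ (ht.1 b hb).2.1.le,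
        ENNReal.ofReal_mul (by norm_num), mul_pow, ENNReal.ofReal_pow (ht.1 b hb).2.1.le, mul_assoc,
        ENNReal.ofReal_ofNat]
    calc ∑ b ∈ t, ENNReal.ofReal (2 * b.2) ^ (s : ℝ)
        ≤ ∑ b ∈ t, ENNReal.ofReal (2 * δ) ^ ((s : ℝ) - n) * ENNReal.ofReal (2 * b.2) ^ n := by
          refine Finset.sum_le_sum fun b hb => ?_
          obtain ⟨-, h0, h1⟩ := ht.1 b hb
          have hpos : ENNReal.ofReal (2 * b.2) ≠ 0 := by
            rw [Ne, ENNReal.ofReal_eq_zero]; linarith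
          rw [← ENNReal.rpow_natCast, show (s : ℝ) = ((s : ℝ) - n) + n by ring,
            ENNReal.rpow_add _ _ hpos ENNReal.ofReal_ne_top]
          simp only [add_sub_cancel_right]
          gcongr
      _ = ENNReal.ofReal (2 * δ) ^ ((s : ℝ) - n) * ∑ b ∈ t, ENNReal.ofReal (2 * b.2) ^ n := by
          rw [Finset.mul_sum]
      _ ≤ _ := by gcongr
  have hlim : Tendsto (fun δ : ℝ => ENNReal.ofReal (2 * δ) ^ ((s : ℝ) - n) * K) (𝓝[>] 0) (𝓝 0) := by
    have h1 : Tendsto (fun δ : ℝ => ENNReal.ofReal (2 * δ) ^ ((s : ℝ) - n)) (𝓝[>] 0) (𝓝 0) := by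
      have h2 : Tendsto (fun δ : ℝ => ENNReal.ofReal (2 * δ)) (𝓝[>] 0) (𝓝 0) := by
        have : Continuous fun δ : ℝ => ENNReal.ofReal (2 * δ) :=
          ENNReal.continuous_ofReal.comp (by fun_prop)
        simpa using (this.tendsto 0).mono_left nhdsWithin_le_nhds
      have h3 := (ENNReal.continuous_rpow_const (y := (s : ℝ) - n)).tendsto 0
      rw [ENNReal.zero_rpow_of_pos (by linarith)] at h3
      exact h3.comp h2
    simpa using ENNReal.Tendsto.mul_const h1 (Or.inr hKt)
  refine le_antisymm (ge_of_tendsto hlim ?_) bot_le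
  filter_upwards [Ioc_mem_nhdsGT (zero_lt_one (α := ℝ))] with δ hδ
  exact (iInf₂_le δ hδ.1).trans (key δ hδ.1 hδ.2)

theorem dimPacking_le_finrank (A : Set E) : dimPacking A ≤ Module.finrank ℝ E := by
  refine iSup₂_le fun s hs => ?_
  by_contra hlt
  rw [not_le, ← ENNReal.coe_natCast, ENNReal.coe_lt_coe] at hlt
  have hlt' : (Module.finrank ℝ E : ℝ) < s := by exact_mod_cast hlt
  have : packingMeasure s A = 0 := by
    refine le_antisymm (iInf₂_le_of_le (fun i : ℕ => A ∩ closedBall 0 i) ?_ ?_) bot_le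
    · intro x hx
      obtain ⟨i, hi⟩ := exists_nat_ge ‖x‖
      exact Set.mem_iUnion.2 ⟨i, hx, by simpa using hi⟩
    · simp [packingPremeasure_eq_zero_of_bounded hlt' (Set.inter_subset_right (s := A))]
  simp [this] at hs

end PackingUpper

/-! ### Upper bound for the Hausdorff dimension -/

/-- Hausdorff–Cantelli lemma. -/
theorem hausdorffMeasure_limsup_eq_zero {X ι : Type*} [EMetricSpace X] [MeasurableSpace X]
    [BorelSpace X] [Countable ι] {s : ℝ} (hs : 0 < s) (U : ι → Set X)
    (hU : ∑' i, ediam (U i) ^ s ≠ ∞) : μH[s] {x | {i | x ∈ U i}.Infinite} = 0 := by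
  have hlim := ENNReal.tendsto_tsum_compl_atTop_zero hU
  -- Each term is at most the whole tail, so the `s`-th root of the tail bounds all diameters in it.
  have hr : Tendsto (fun F : Finset ι => (∑' i : {i // i ∉ F}, ediam (U i) ^ s) ^ s⁻¹) atTop
      (𝓝 0) := by
    have h := (ENNReal.continuous_rpow_const (y := s⁻¹)).tendsto 0
    rw [ENNReal.zero_rpow_of_pos (by positivity)] at h
    exact h.comp hlim
  have h := Measure.hausdorffMeasure_le_liminf_tsum (l := (atTop : Filter (Finset ι)))
    (ι := fun F => {i // i ∉ F}) s {x | {i | x ∈ U i}.Infinite} _ hr (fun F i => U i)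
    (Eventually.of_forall fun F i => by
      calc ediam (U i) = (ediam (U i) ^ s) ^ s⁻¹ := by
            rw [← ENNReal.rpow_mul, mul_inv_cancel₀ hs.ne', ENNReal.rpow_one]
        _ ≤ _ := by
            gcongr
            exact ENNReal.le_tsum (f := fun i : {i // i ∉ F} => ediam (U i) ^ s) i)
    (Eventually.of_forall fun F x hx => by
      obtain ⟨i, hi, hiF⟩ := Set.Infinite.exists_notMem_finset hx F
      exact Set.mem_iUnion.2 ⟨⟨i, hiF⟩, hi⟩)
  rw [hlim.liminf_eq] at h
  exact le_antisymm h bot_le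

theorem rpow_neg_den_anti (r : ℚ) {a b : ℝ} (h : a ≤ b) :
    (r.den : ℝ) ^ (-b) ≤ (r.den : ℝ) ^ (-a) :=
  Real.rpow_le_rpow_of_exponent_le (by exact_mod_cast r.pos) (by linarith)

theorem infinite_of_lt_irrationalityExponent {ξ : ℝ} {ν : ℝ≥0} (h : ν < irrationalityExponent ξ) :
    {r : ℚ | |ξ - (r : ℝ)| ≤ (r.den : ℝ) ^ (-(ν : ℝ))}.Infinite := by
  simp only [irrationalityExponent, lt_iSup_iff] at h
  obtain ⟨ν', hinf, hlt⟩ := h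
  refine hinf.mono fun r hr => le_trans hr (rpow_neg_den_anti r ?_)
  exact_mod_cast hlt.le

theorem dist_le_add_abs (x y : EuclideanSpace ℝ (Fin 2)) :
    dist x y ≤ |x 0 - y 0| + |x 1 - y 1| := by
  rw [EuclideanSpace.dist_eq, Real.sqrt_le_left (by positivity)]
  simp only [Fin.sum_univ_two, Real.dist_eq]
  nlinarith [abs_nonneg (x 0 - y 0), abs_nonneg (x 1 - y 1)]

/-- Squares of side `2 q ^ (-n)` around the points `(p / q, j / q ^ n)`. -/
def rationalSquare (n q : ℕ) (p j : ℤ) : Set (EuclideanSpace ℝ (Fin 2)) :=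
  {x | |x 0 - p / q| ≤ ((q : ℝ) ^ n)⁻¹ ∧ |x 1 - j / (q : ℝ) ^ n| ≤ ((q : ℝ) ^ n)⁻¹}

theorem ediam_rationalSquare_le (n q : ℕ) (p j : ℤ) :
    ediam (rationalSquare n q p j) ≤ ENNReal.ofReal (4 * ((q : ℝ) ^ n)⁻¹) := by
  refine ediam_le fun x hx y hy => ?_
  rw [edist_dist]
  refine ENNReal.ofReal_le_ofReal ((dist_le_add_abs x y).trans ?_)
  have h0 := abs_sub_le (x 0) (p / q) (y 0)
  have h1 := abs_sub_le (x 1) (j / (q : ℝ) ^ n) (y 1)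
  rw [abs_sub_comm (_ / _) (y 0)] at h0
  rw [abs_sub_comm (_ / _) (y 1)] at h1
  linarith [hx.1, hx.2, hy.1, hy.2]

/-- The squares of `rationalSquare` that are needed to cover the part of the plane within
distance `N` of the axes. -/
abbrev SquareIndex (n N : ℕ) : Type :=
  Σ q : ℕ, ↥(Finset.Icc (-(((N + 1) * q : ℕ) : ℤ)) ((N + 1) * q : ℕ)) ×
    ↥(Finset.Icc (-(((N + 1) * q ^ n : ℕ) : ℤ)) ((N + 1) * q ^ n : ℕ))

/-- For fixed `q` there are about `q ^ (n + 1)` squares, each contributing about `(q ^ (-n)) ^ (1 +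
3 / n) = q ^ (-(n + 3))`; this leaves `q ^ (-2)`. -/
theorem tsum_ediam_rationalSquare_ne_top {n : ℕ} (hn : n ≠ 0) (N : ℕ) :
    ∑' i : SquareIndex n N, ediam (rationalSquare n i.1 i.2.1 i.2.2) ^ (1 + 3 / n : ℝ) ≠ ∞ := by
  have hn' : (0 : ℝ) < n := by positivity
  rw [ENNReal.tsum_sigma']
  set c : ℝ := (2 * (N + 1) + 1) * (2 * (N + 1) + 1) * 4 ^ (1 + 3 / n : ℝ) with hc
  have hsum : Summable fun q : ℕ => c * (1 / (q : ℝ) ^ 2) :=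
    (Real.summable_one_div_nat_pow.2 one_lt_two).mul_left c
  refine ne_top_of_le_ne_top (hsum.tsum_ofReal_ne_top) (ENNReal.tsum_le_tsum fun q => ?_)
  rw [tsum_fintype]
  refine (Finset.sum_le_sum fun i _ =>
    ENNReal.rpow_le_rpow (ediam_rationalSquare_le n q i.1 i.2) (by positivity)).trans ?_
  rcases Nat.eq_zero_or_pos q with rfl | hq
  -- For `q = 0` the diameter bound is `0`, because `0 ^ n = 0` and its inverse is `0` by
  -- convention.
  · have : (0 : ℝ) < 1 + 3 / n := by positivity
    simp [hn, this]
  rw [ENNReal.ofReal_rpow_of_nonneg (by positivity) (by positivity), Finset.sum_const,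
    nsmul_eq_mul, ← ENNReal.ofReal_natCast, ← ENNReal.ofReal_mul (by positivity)]
  refine ENNReal.ofReal_le_ofReal ?_
  have hq1 : (1 : ℝ) ≤ q := by exact_mod_cast hq
  have hqn : (1 : ℝ) ≤ (q : ℝ) ^ n := one_le_pow₀ hq1
  have hcard : (((Finset.univ : Finset (↥(Finset.Icc (-(((N + 1) * q : ℕ) : ℤ)) ((N + 1) * q : ℕ)) ×
      ↥(Finset.Icc (-(((N + 1) * q ^ n : ℕ) : ℤ)) ((N + 1) * q ^ n : ℕ)))).card : ℕ) : ℝ) =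
      (2 * ((N + 1) * q) + 1) * (2 * ((N + 1) * q ^ n) + 1) := by
    have h : ∀ a : ℕ, ((a : ℤ) + 1 - -(a : ℤ)).toNat = 2 * a + 1 := fun a => by omega
    rw [Finset.card_univ, Fintype.card_prod, Fintype.card_coe, Fintype.card_coe, Int.card_Icc,
      Int.card_Icc, h, h]
    push_cast
    ring
  rw [hcard, Real.mul_rpow (by norm_num) (by positivity)]
  have hpow : (((q : ℝ) ^ n)⁻¹) ^ (1 + 3 / n : ℝ) = (q : ℝ)⁻¹ ^ (n + 3) := by
    rw [← inv_pow, ← Real.rpow_natCast, ← Real.rpow_mul (by positivity), ← Real.rpow_natCast]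
    congr 1
    push_cast
    field_simp
  rw [hpow]
  have h1 : (2 * ((N + 1) * q) + 1 : ℝ) ≤ (2 * (N + 1) + 1) * q := by nlinarith
  have h2 : (2 * ((N + 1) * q ^ n) + 1 : ℝ) ≤ (2 * (N + 1) + 1) * q ^ n := by nlinarith
  calc (2 * ((N + 1) * q) + 1 : ℝ) * (2 * ((N + 1) * q ^ n) + 1) *
        (4 ^ (1 + 3 / n : ℝ) * (q : ℝ)⁻¹ ^ (n + 3))
      ≤ ((2 * (N + 1) + 1) * q) * ((2 * (N + 1) + 1) * q ^ n) *
        (4 ^ (1 + 3 / n : ℝ) * (q : ℝ)⁻¹ ^ (n + 3)) := by gcongr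
    _ = c * (1 / (q : ℝ) ^ 2) := by
        rw [hc]
        have : (q : ℝ) ≠ 0 := by positivity
        simp only [inv_pow, pow_add]
        field_simp

/-- Each approximation `p / q` of the first coordinate selects a square: the second coordinate
always has a grid point `j / q ^ n` nearby, obtained by rounding down. The square remembers `p / q`,
so infinitely many squares occur. -/
theorem infinite_rationalSquare {n N : ℕ} {x : EuclideanSpace ℝ (Fin 2)} (h0 : |x 0| ≤ N)
    (h1 : |x 1| ≤ N) (hx : (n : ℝ≥0∞) < irrationalityExponent (x 0)) :
    {i : SquareIndex n N | x ∈ rationalSquare n i.1 i.2.1 i.2.2}.Infinite := by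
  have hinf := infinite_of_lt_irrationalityExponent (ξ := x 0) (ν := n) (by exact_mod_cast hx)
  have key : ∀ r : ℚ, |x 0 - (r : ℝ)| ≤ (r.den : ℝ) ^ (-((n : ℝ≥0) : ℝ)) →
      ∃ i : SquareIndex n N, x ∈ rationalSquare n i.1 i.2.1 i.2.2 ∧ i.1 = r.den ∧
        (i.2.1 : ℤ) = r.num := by
    intro r hr
    have hq : (1 : ℝ) ≤ r.den := by exact_mod_cast r.pos
    have hqn : (1 : ℝ) ≤ (r.den : ℝ) ^ n := one_le_pow₀ hq
    have hrnum : (r : ℝ) = r.num / r.den := Rat.cast_def r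
    rw [NNReal.coe_natCast, Real.rpow_neg (by positivity), Real.rpow_natCast, hrnum] at hr
    have hle1 : ((r.den : ℝ) ^ n)⁻¹ ≤ 1 := inv_le_one_of_one_le₀ hqn
    have hp : |(r.num : ℝ)| ≤ (N + 1) * r.den := by
      rw [← div_le_iff₀ (by positivity)]
      have e : |(r.num : ℝ)| / r.den = |(r.num : ℝ) / r.den| := by
        rw [abs_div, abs_of_pos (show (0 : ℝ) < r.den by positivity)]
      rw [e]
      have := abs_sub_abs_le_abs_sub ((r.num : ℝ) / r.den) (x 0)
      rw [abs_sub_comm] at this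
      linarith
    set j : ℤ := ⌊x 1 * (r.den : ℝ) ^ n⌋ with hj
    have hj1 : (j : ℝ) ≤ x 1 * (r.den : ℝ) ^ n := Int.floor_le _
    have hj2 : x 1 * (r.den : ℝ) ^ n < j + 1 := Int.lt_floor_add_one _
    have hp' := abs_le.1 hp
    have h1' := abs_le.1 h1
    refine ⟨⟨r.den, ⟨r.num, ?_⟩, ⟨j, ?_⟩⟩, ⟨hr, ?_⟩, rfl, rfl⟩
    · rw [Finset.mem_Icc]
      constructor
      · have := hp'.1
        exact_mod_cast this
      · have := hp'.2
        exact_mod_cast this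
    · rw [Finset.mem_Icc]
      constructor
      · have : (-((N + 1) * (r.den : ℝ) ^ n) : ℝ) ≤ j := by nlinarith
        exact_mod_cast this
      · have : (j : ℝ) ≤ (N + 1) * (r.den : ℝ) ^ n := by nlinarith
        exact_mod_cast this
    · have e : x 1 - j / (r.den : ℝ) ^ n =
          (x 1 * (r.den : ℝ) ^ n - j) * ((r.den : ℝ) ^ n)⁻¹ := by
        field_simp
      rw [e, abs_mul, abs_of_nonneg (by linarith), abs_of_pos (a := ((r.den : ℝ) ^ n)⁻¹)
        (by positivity)]
      exact mul_le_of_le_one_left (by positivity) (by linarith)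
  intro hfin
  refine hinf ((hfin.image fun i : SquareIndex n N => ((i.2.1 : ℤ) / (i.1 : ℚ) : ℚ)).subset
    fun r hr => ?_)
  obtain ⟨i, hi, hd, hnum⟩ := key r hr
  exact ⟨i, hi, by simp only [hd, hnum, Rat.num_div_den]⟩

theorem dimH_planarProduct_le {n : ℕ} (hn : n ≠ 0) {l : ℝ≥0∞} (hl : n < l) (B : Set ℝ) :
    dimH (planarProduct (exactOrderSet l) B) ≤ 1 + 3 / n := by
  have hsub : planarProduct (exactOrderSet l) B ⊆ ⋃ N : ℕ,
      {x | {i : SquareIndex n N | x ∈ rationalSquare n i.1 i.2.1 i.2.2}.Infinite} := by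
    intro x hx
    obtain ⟨N, hN⟩ := exists_nat_ge (max |x 0| |x 1|)
    refine Set.mem_iUnion.2 ⟨N, infinite_rationalSquare ((le_max_left _ _).trans hN)
      ((le_max_right _ _).trans hN) ?_⟩
    have h : irrationalityExponent (x 0) = l := hx.1
    rwa [h]
  refine (dimH_mono hsub).trans ?_
  rw [dimH_iUnion]
  refine iSup_le fun N => ?_
  have hz := hausdorffMeasure_limsup_eq_zero (s := 1 + 3 / n) (by positivity)
    (fun i : SquareIndex n N => rationalSquare n i.1 i.2.1 i.2.2)
    (tsum_ediam_rationalSquare_ne_top hn N)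
  have hcast : ((1 + 3 / n : ℝ≥0) : ℝ) = 1 + 3 / n := by simp
  rw [← hcast] at hz
  refine (dimH_le_of_hausdorffMeasure_ne_top (d := 1 + 3 / n) (by rw [hz]; simp)).trans
    (le_of_eq ?_)
  rw [ENNReal.coe_add, ENNReal.coe_div (by exact_mod_cast hn)]
  simp

/-! ### Binary expansions -/

section BinaryDigits

/-- The integer part of `2 ^ m * 0.d₀d₁d₂…`. -/
def binaryPrefix (d : ℕ → Fin 2) : ℕ → ℕ
  | 0 => 0
  | m + 1 => 2 * binaryPrefix d m + d m

theorem binaryPrefix_injective {d d' : ℕ → Fin 2} {m : ℕ}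
    (h : binaryPrefix d m = binaryPrefix d' m) : ∀ i < m, d i = d' i := by
  induction m with
  | zero => simp
  | succ m ih =>
    simp only [binaryPrefix] at h
    intro i hi
    rcases Nat.lt_succ_iff_lt_or_eq.1 hi with hi | rfl
    · exact ih (by omega) i hi
    · exact Fin.ext (by omega)

theorem sum_ofDigitsTerm_eq_binaryPrefix (d : ℕ → Fin 2) (m : ℕ) :
    ∑ i ∈ Finset.range m, Real.ofDigitsTerm d i = binaryPrefix d m / 2 ^ m := by
  induction m with
  | zero => simp [binaryPrefix]
  | succ m ih =>
    rw [Finset.sum_range_succ, ih, Real.ofDigitsTerm, binaryPrefix]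
    push_cast
    field_simp
    ring

theorem binaryPrefix_div_le (d : ℕ → Fin 2) (m : ℕ) :
    binaryPrefix d m / 2 ^ m ≤ Real.ofDigits d := by
  rw [Real.ofDigits_eq_sum_add_ofDigits d m, sum_ofDigitsTerm_eq_binaryPrefix]
  have := Real.ofDigits_nonneg fun i => d (i + m)
  exact le_add_of_nonneg_right (by positivity)

theorem ofDigits_sub_binaryPrefix_le (d : ℕ → Fin 2) (m : ℕ) :
    Real.ofDigits d - binaryPrefix d m / 2 ^ m ≤ (2 ^ m)⁻¹ := by
  rw [Real.ofDigits_eq_sum_add_ofDigits d m, sum_ofDigitsTerm_eq_binaryPrefix, add_sub_cancel_left]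
  exact_mod_cast mul_le_of_le_one_right (by positivity) (Real.ofDigits_le_one fun i => d (i + m))

theorem binaryPrefix_of_zeros {d : ℕ → Fin 2} {m n : ℕ} (hmn : m ≤ n)
    (h : ∀ i, m ≤ i → i < n → d i = 0) : binaryPrefix d n = 2 ^ (n - m) * binaryPrefix d m := by
  induction n, hmn using Nat.le_induction with
  | base => simp
  | succ n hmn ih =>
    rw [binaryPrefix, ih fun i h1 h2 => h i h1 (by omega), h n hmn (by omega), Nat.succ_sub hmn,
      pow_succ]
    simp
    ring

end BinaryDigits

/-! ### Random digits and small-ball estimates -/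

section RandomDigits

/-- The uniform measure on binary sequences. -/
noncomputable def coinMeasure : Measure (ℕ → Fin 2) :=
  Measure.infinitePi fun _ => ProbabilityTheory.uniformOn (Set.univ : Set (Fin 2))

instance : IsProbabilityMeasure (ProbabilityTheory.uniformOn (Set.univ : Set (Fin 2))) :=
  ProbabilityTheory.isProbabilityMeasure_uniformOn Set.finite_univ Set.univ_nonempty

instance : IsProbabilityMeasure coinMeasure := by
  unfold coinMeasure
  infer_instance

theorem coinMeasure_cylinder (S : Finset ℕ) (d : ℕ → Fin 2) :
    coinMeasure {ω | ∀ i ∈ S, ω i = d i} = 2⁻¹ ^ S.card := by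
  have h : {ω : ℕ → Fin 2 | ∀ i ∈ S, ω i = d i} = Set.pi S fun i => {d i} := by
    ext ω
    simp
  rw [h, coinMeasure, Measure.infinitePi_pi _ fun _ _ => MeasurableSet.singleton _]
  simp [ProbabilityTheory.uniformOn_univ]

open Classical in
/-- The sequence that agrees with `ω` on `F` and with `c` off `F`. -/
noncomputable def prescribeDigits (F : Set ℕ) (c ω : ℕ → Fin 2) : ℕ → Fin 2 :=
  fun n => if n ∈ F then ω n else c n

/-- A real number whose binary digits in `F` are taken from `ω`, the other ones from `c`. -/
noncomputable def randomReal (F : Set ℕ) (c ω : ℕ → Fin 2) : ℝ :=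
  Real.ofDigits (prescribeDigits F c ω)

theorem measurable_randomReal (F : Set ℕ) (c : ℕ → Fin 2) : Measurable (randomReal F c) := by
  refine Real.continuous_ofDigits.measurable.comp (measurable_pi_lambda _ fun n => ?_)
  unfold prescribeDigits
  split_ifs
  · exact measurable_pi_apply n
  · exact measurable_const

open Classical in
/-- The number of elements of `F` below `m`. -/
noncomputable def freeCount (F : Set ℕ) (m : ℕ) : ℕ := ((Finset.range m).filter (· ∈ F)).card

/-- The prefix determines every digit below `m`, so the event lies in a cylinder fixing all free
digits there. -/
theorem coinMeasure_binaryPrefix_eq_le (F : Set ℕ) (c : ℕ → Fin 2) (m : ℕ) (a : ℤ) :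
    coinMeasure {ω | (binaryPrefix (prescribeDigits F c ω) m : ℤ) = a} ≤ 2⁻¹ ^ freeCount F m := by
  classical
  rcases Set.eq_empty_or_nonempty {ω | (binaryPrefix (prescribeDigits F c ω) m : ℤ) = a} with
    h | ⟨ω₀, hω₀⟩
  · simp [h]
  rw [freeCount, ← coinMeasure_cylinder _ ω₀]
  refine measure_mono fun ω hω i hi => ?_
  simp only [Finset.mem_filter, Finset.mem_range] at hi
  have h1 : binaryPrefix (prescribeDigits F c ω) m = binaryPrefix (prescribeDigits F c ω₀) m := by
    have := hω.trans hω₀.symm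
    exact_mod_cast this
  have h2 := binaryPrefix_injective h1 i hi.1
  simpa [prescribeDigits, hi.2] using h2

theorem coinMeasure_abs_sub_le (F : Set ℕ) (c : ℕ → Fin 2) (m : ℕ) (x : ℝ) :
    coinMeasure {ω | |randomReal F c ω - x| ≤ (2 ^ m)⁻¹} ≤ 4 * 2⁻¹ ^ freeCount F m := by
  -- The prefix is between `2 ^ m * ξ - 1` and `2 ^ m * ξ`, and `2 ^ m * ξ` is within `1` of `2 ^ m
  -- * x`: at most four integers remain.
  set I := Finset.Icc ⌈2 ^ m * x - 2⌉ ⌊2 ^ m * x + 1⌋ with hI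
  have hcard : I.card ≤ 4 := by
    rw [hI, Int.card_Icc]
    have h1 : (⌊2 ^ m * x + 1⌋ : ℝ) ≤ 2 ^ m * x + 1 := Int.floor_le _
    have h2 : 2 ^ m * x - 2 ≤ ⌈2 ^ m * x - 2⌉ := Int.le_ceil _
    have h3 : (⌊2 ^ m * x + 1⌋ : ℝ) ≤ (⌈2 ^ m * x - 2⌉ + 3 : ℤ) := by
      push_cast
      linarith
    have h4 : ⌊2 ^ m * x + 1⌋ ≤ ⌈2 ^ m * x - 2⌉ + 3 := by exact_mod_cast h3
    omega
  have hsub : {ω | |randomReal F c ω - x| ≤ (2 ^ m)⁻¹} ⊆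
      ⋃ a ∈ I, {ω | (binaryPrefix (prescribeDigits F c ω) m : ℤ) = a} := by
    intro ω hω
    simp only [Set.mem_iUnion]
    refine ⟨_, ?_, rfl⟩
    have h1 := binaryPrefix_div_le (prescribeDigits F c ω) m
    have h2 := ofDigits_sub_binaryPrefix_le (prescribeDigits F c ω) m
    have h3 := abs_le.1 (Set.mem_ofPred.1 hω)
    unfold randomReal at h3
    set ξ := Real.ofDigits (prescribeDigits F c ω)
    set b := binaryPrefix (prescribeDigits F c ω) m
    have hpos : (0 : ℝ) < 2 ^ m := by positivity
    rw [div_le_iff₀ hpos] at h1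
    have h4 : (2 : ℝ) ^ m * (2 ^ m)⁻¹ = 1 := mul_inv_cancel₀ hpos.ne'
    have h5 : ξ * 2 ^ m - b ≤ 1 := by
      have := mul_le_mul_of_nonneg_left h2 hpos.le
      rw [h4, mul_sub, mul_div_cancel₀ _ hpos.ne'] at this
      linarith
    have h6 := mul_le_mul_of_nonneg_left h3.1 hpos.le
    have h7 := mul_le_mul_of_nonneg_left h3.2 hpos.le
    rw [hI, Finset.mem_Icc, Int.ceil_le, Int.le_floor]
    push_cast
    constructor <;> linarith
  calc _ ≤ ∑ a ∈ I, coinMeasure {ω | (binaryPrefix (prescribeDigits F c ω) m : ℤ) = a} :=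
        (measure_mono hsub).trans (measure_biUnion_finset_le _ _)
    _ ≤ ∑ _a ∈ I, 2⁻¹ ^ freeCount F m :=
        Finset.sum_le_sum fun a _ => coinMeasure_binaryPrefix_eq_le F c m a
    _ ≤ 4 * 2⁻¹ ^ freeCount F m := by
        rw [Finset.sum_const, nsmul_eq_mul]
        gcongr
        exact_mod_cast hcard

end RandomDigits

/-! ### Irrationality exponent of numbers with long gaps -/

section Gaps

/-- The blocks `[s k, e k]` of binary digits are disjoint and in increasing order, and the ratio
`e k / (s k + 1)` is large and has upper limit `l`, in fact limit `l`. -/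
structure IsBlockSequence (l : ℝ≥0∞) (s e : ℕ → ℕ) : Prop where
  block_lt : ∀ k, e k < s (k + 1)
  eight_mul_le : ∀ k, 8 * (s k + 1) ≤ e k
  eventually_le : ∀ ν : ℝ≥0, ν < l → ∀ᶠ k in atTop, (ν : ℝ) * (s k + 1 : ℕ) ≤ e k
  eventually_lt : ∀ ν : ℝ≥0, l < ν → ∀ᶠ k in atTop, (e k + 1 : ℝ) < ν * (s k + 1 : ℕ)

/-- The digits at the ends of the blocks are `1`, and those in their interiors are `0`. -/
def IsGapped (s e : ℕ → ℕ) (d : ℕ → Fin 2) : Prop :=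
  ∀ k, d (s k) = 1 ∧ d (e k) = 1 ∧ ∀ n, s k < n → n < e k → d n = 0

/-- The dyadic rational given by the digits up to the start of the `k`-th block. -/
noncomputable def truncation (s : ℕ → ℕ) (d : ℕ → Fin 2) (k : ℕ) : ℚ :=
  ((binaryPrefix d (s k + 1) : ℤ) : ℚ) / ((2 ^ (s k + 1) : ℤ) : ℚ)

theorem cast_truncation (s : ℕ → ℕ) (d : ℕ → Fin 2) (k : ℕ) :
    (truncation s d k : ℝ) = binaryPrefix d (s k + 1) / 2 ^ (s k + 1) := by
  simp [truncation]

variable {l : ℝ≥0∞} {s e : ℕ → ℕ} {d : ℕ → Fin 2}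

/-- The digit `1` at the block start makes the numerator odd, so the fraction is already reduced. -/
theorem truncation_den {k : ℕ} (h : d (s k) = 1) : (truncation s d k).den = 2 ^ (s k + 1) := by
  have hodd : Odd (binaryPrefix d (s k + 1)) := ⟨binaryPrefix d (s k), by simp [binaryPrefix, h]⟩
  have h1 : Nat.Coprime (binaryPrefix d (s k + 1) : ℤ).natAbs (2 ^ (s k + 1) : ℤ).natAbs := by
    rw [Int.natAbs_natCast, Int.natAbs_pow]
    exact (Nat.coprime_two_right.2 hodd).pow_right _
  have h2 := Rat.den_div_eq_of_coprime (by positivity) h1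
  exact Nat.cast_injective (R := ℤ) (h2.trans (by push_cast; rfl))

/-- The zeros in the block make the truncation equal to the one at `e k`; the digit `1` at `e k`
keeps the error from being smaller. -/
theorem truncation_bounds {k : ℕ} (hse : s k < e k) (h1 : d (e k) = 1)
    (h0 : ∀ n, s k < n → n < e k → d n = 0) :
    (2 ^ (e k + 1))⁻¹ ≤ Real.ofDigits d - truncation s d k ∧
      Real.ofDigits d - truncation s d k ≤ (2 ^ e k)⁻¹ := by
  have hz := binaryPrefix_of_zeros (d := d) (m := s k + 1) (n := e k) hse
    fun i hi hi' => h0 i hi hi'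
  have htr : (truncation s d k : ℝ) = binaryPrefix d (e k) / 2 ^ e k := by
    obtain ⟨t, ht⟩ := Nat.exists_eq_add_of_le hse
    rw [cast_truncation, hz, ht, Nat.succ_eq_add_one, Nat.add_sub_cancel_left, pow_add _ _ t]
    push_cast
    field_simp
  rw [htr]
  refine ⟨?_, ofDigits_sub_binaryPrefix_le d (e k)⟩
  have h2 := binaryPrefix_div_le d (e k + 1)
  rw [binaryPrefix, h1] at h2
  have h3 : ((2 * binaryPrefix d (e k) + ((1 : Fin 2) : ℕ) : ℕ) : ℝ) / 2 ^ (e k + 1) =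
      binaryPrefix d (e k) / 2 ^ e k + (2 ^ (e k + 1))⁻¹ := by
    rw [pow_succ]
    push_cast
    field_simp
    simp
  linarith

theorem rpow_neg_den_le_two_pow_inv {r : ℚ} {ν : ℝ} (hν : 8 ≤ ν) :
    (r.den : ℝ) ^ (-ν) ≤ (2 ^ (8 * Nat.log 2 r.den))⁻¹ := by
  refine (rpow_neg_den_anti r hν).trans ?_
  have h1 : ((2 ^ Nat.log 2 r.den : ℕ) : ℝ) ≤ r.den := by
    exact_mod_cast Nat.pow_log_le_self 2 r.den_nz
  rw [Real.rpow_neg (by positivity), mul_comm, pow_mul]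
  push_cast at h1
  rw [show (8 : ℝ) = ((8 : ℕ) : ℝ) by norm_num, Real.rpow_natCast]
  gcongr

namespace IsBlockSequence

theorem start_lt_end (h : IsBlockSequence l s e) (k : ℕ) : s k < e k := by
  have := h.eight_mul_le k
  omega

theorem strictMono_start (h : IsBlockSequence l s e) : StrictMono s :=
  strictMono_nat_of_lt_succ fun k => (h.start_lt_end k).trans (h.block_lt k)

theorem end_lt_start (h : IsBlockSequence l s e) {j k : ℕ} (hjk : j < k) : e j < s k :=
  (h.block_lt j).trans_le (h.strictMono_start.monotone hjk)

theorem eq_of_mem (h : IsBlockSequence l s e) {j k n : ℕ} (hj : s j ≤ n) (hj' : n ≤ e j)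
    (hk : s k ≤ n) (hk' : n ≤ e k) : j = k := by
  rcases lt_trichotomy j k with hlt | rfl | hlt
  · have := h.end_lt_start hlt
    omega
  · rfl
  · have := h.end_lt_start hlt
    omega

/-- The truncations are the approximations: denominator `2 ^ (s k + 1)`, error at most `2 ^ (-e k)`,
and pairwise distinct denominators. -/
theorem le_irrationalityExponent (h : IsBlockSequence l s e) (hd : IsGapped s e d) :
    l ≤ irrationalityExponent (Real.ofDigits d) := by
  refine ENNReal.le_of_forall_nnreal_lt fun ν hν => ?_
  refine le_iSup₂_of_le ν ?_ le_rfl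
  obtain ⟨K, hK⟩ := eventually_atTop.1 (h.eventually_le ν hν)
  refine Set.infinite_of_injective_forall_mem (f := fun j : ℕ => truncation s d (K + j)) ?_ ?_
  · intro i j hij
    have h1 := congrArg Rat.den hij
    simp only [truncation_den (hd _).1] at h1
    have h2 := Nat.pow_right_injective le_rfl h1
    have h3 := h.strictMono_start.injective (Nat.succ_injective h2)
    omega
  · intro j
    have hb := truncation_bounds (h.start_lt_end (K + j)) (hd _).2.1 (hd _).2.2
    have hpos : (0 : ℝ) ≤ (2 ^ (e (K + j) + 1))⁻¹ := by positivity
    rw [Set.mem_ofPred, abs_of_nonneg (hpos.trans hb.1), truncation_den (hd _).1]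
    refine hb.2.trans ?_
    push_cast
    rw [← Real.rpow_natCast, ← Real.rpow_natCast, ← Real.rpow_mul (by norm_num),
      ← Real.rpow_neg (by norm_num)]
    refine Real.rpow_le_rpow_of_exponent_le (by norm_num) ?_
    have := hK (K + j) (by omega)
    linarith

/-- The denominators for which no truncation excludes good approximations. -/
def IsExceptionalDen (s e : ℕ → ℕ) (q : ℕ) : Prop :=
  ∃ j, e j ≤ s j + Nat.log 2 q + 2 ∧ 7 * Nat.log 2 q ≤ s (j + 1) + 2

/-- A good rational approximation with a denominator that is not exceptional is a truncation. -/
theorem eq_truncation (h : IsBlockSequence l s e) (hd : IsGapped s e d) {K : ℕ} {r : ℚ}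
    (hr : |Real.ofDigits d - r| ≤ (2 ^ (8 * Nat.log 2 r.den))⁻¹)
    (hK : s K + 2 < 7 * Nat.log 2 r.den) (hex : ¬ IsExceptionalDen s e r.den) :
    ∃ j, K ≤ j ∧ r = truncation s d j := by
  set L := Nat.log 2 r.den with hL
  have hex' : ∃ k, 7 * L ≤ s k + 2 := ⟨7 * L, by
    have := h.strictMono_start.le_apply (x := 7 * L)
    omega⟩
  -- `r` is compared with the truncation at the last block having `s + 2 < 7 * L`, the one just
  -- before this `k`.
  obtain ⟨k, hk, hmin⟩ : ∃ k, 7 * L ≤ s k + 2 ∧ ∀ i < k, ¬ 7 * L ≤ s i + 2 :=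
    ⟨Nat.find hex', Nat.find_spec hex', fun i hi => Nat.find_min hex' hi⟩
  have hKk : K < k := by
    by_contra hcon
    have := h.strictMono_start.monotone (not_lt.1 hcon)
    omega
  obtain ⟨j, rfl⟩ := Nat.exists_eq_add_of_lt hKk
  refine ⟨K + j, by omega, ?_⟩
  have hj : s (K + j) + 2 < 7 * L := not_le.1 (hmin (K + j) (by omega))
  have hgap : s (K + j) + L + 2 < e (K + j) := by
    by_contra hcon
    exact hex ⟨K + j, by omega, hk⟩
  by_contra hne
  set V := s (K + j) + 1 with hV
  have hb := truncation_bounds (h.start_lt_end (K + j)) (hd _).2.1 (hd _).2.2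
  have hpos : (0 : ℝ) ≤ (2 ^ (e (K + j) + 1))⁻¹ := by positivity
  have hq : (r.den : ℝ) < 2 ^ (L + 1) := by
    exact_mod_cast Nat.lt_pow_succ_log_self one_lt_two r.den
  have hqpos : (0 : ℝ) < r.den := by exact_mod_cast r.pos
  -- Distinct fractions differ by at least the inverse product of their denominators. Both errors
  -- are too small for this: `2 ^ (-8 * L)` because `s (K + j) + 2 < 7 * L`, and `2 ^ (-e (K + j))`
  -- by `hgap`.
  have hsep : (r.den * 2 ^ V : ℝ)⁻¹ ≤ |(r : ℝ) - truncation s d (K + j)| := by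
    have hne' : r.num * 2 ^ V - binaryPrefix d V * r.den ≠ 0 := by
      intro h0
      apply hne
      rw [truncation, ← hV, ← Rat.num_div_den r, div_eq_div_iff]
      · have : r.num * 2 ^ V = binaryPrefix d V * (r.den : ℤ) := by linarith
        exact_mod_cast this
      · simp
      · simp
    have h1 : (1 : ℝ) ≤ |(r.num * 2 ^ V - binaryPrefix d V * r.den : ℝ)| := by
      exact_mod_cast Int.one_le_abs hne'
    rw [cast_truncation, ← hV, Rat.cast_def r, div_sub_div _ _ hqpos.ne' (by positivity), abs_div,
      abs_of_pos (show (0 : ℝ) < r.den * 2 ^ V by positivity), inv_eq_one_div]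
    refine div_le_div_of_nonneg_right (h1.trans (le_of_eq ?_)) (by positivity)
    ring_nf
  have htri : |(r : ℝ) - truncation s d (K + j)| ≤ (2 ^ (8 * L))⁻¹ + (2 ^ e (K + j))⁻¹ := by
    refine (abs_sub_le _ (Real.ofDigits d) _).trans (add_le_add ?_ ?_)
    · rwa [abs_sub_comm]
    · rw [abs_of_nonneg (hpos.trans hb.1)]
      exact hb.2
  have hq' : (2 ^ (L + 1 + V) : ℝ)⁻¹ < (r.den * 2 ^ V : ℝ)⁻¹ := by
    rw [pow_add]
    gcongr
  have h1 : (2 ^ (8 * L) : ℝ)⁻¹ ≤ (2 ^ (L + 1 + V + 1))⁻¹ := by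
    gcongr
    · norm_num
    · omega
  have h2 : (2 ^ e (K + j) : ℝ)⁻¹ ≤ (2 ^ (L + 1 + V + 1))⁻¹ := by
    gcongr
    · norm_num
    · omega
  have h3 : (2 ^ (L + 1 + V + 1) : ℝ)⁻¹ + (2 ^ (L + 1 + V + 1))⁻¹ = (2 ^ (L + 1 + V))⁻¹ := by
    rw [pow_succ _ (L + 1 + V)]
    field_simp
    norm_num
  linarith

/-- For `ν > l`, an approximation of order `ν` with large denominator would have to be a truncation,
but late truncations have error at least `2 ^ (-(e k + 1))`, which exceeds the denominator to the
power `-ν`. Only numerators in `[-q, 2 * q]` matter since the number lies in `[0, 1]`. -/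
theorem irrationalityExponent_le (h : IsBlockSequence l s e) (hl : 8 ≤ l) (hd : IsGapped s e d)
    (hbad : ∀ᶠ q : ℕ in atTop, IsExceptionalDen s e q → ∀ p : ℤ, -(q : ℤ) ≤ p → p ≤ 2 * q →
      (2 ^ (8 * Nat.log 2 q))⁻¹ < |Real.ofDigits d - p / q|) :
    irrationalityExponent (Real.ofDigits d) ≤ l := by
  refine iSup₂_le fun ν hν => ?_
  by_contra hlt
  rw [not_le] at hlt
  have hν8 : (8 : ℝ) ≤ ν := by
    have : (8 : ℝ≥0∞) ≤ ν := hl.trans hlt.le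
    exact_mod_cast this
  obtain ⟨K, hK⟩ := eventually_atTop.1 (h.eventually_lt ν hlt)
  obtain ⟨Q, hQ⟩ := eventually_atTop.1 hbad
  have hbound : ∀ r : ℚ, |Real.ofDigits d - r| ≤ (r.den : ℝ) ^ (-(ν : ℝ)) →
      r.den < max Q (2 ^ (s K + 3)) ∧ -(r.den : ℤ) ≤ r.num ∧ r.num ≤ 2 * r.den := by
    intro r hr
    have hr8 := hr.trans (rpow_neg_den_le_two_pow_inv (r := r) hν8)
    have hr1 : |Real.ofDigits d - r| ≤ 1 :=
      hr8.trans (inv_le_one_of_one_le₀ (one_le_pow₀ one_le_two))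
    have hξ0 := Real.ofDigits_nonneg d
    have hξ1 := Real.ofDigits_le_one d
    have hqpos : (0 : ℝ) < r.den := by exact_mod_cast r.pos
    have hr1' := abs_le.1 hr1
    rw [Rat.cast_def r] at hr1'
    have hn1 : -(r.den : ℝ) ≤ r.num := by
      have h1 : -1 ≤ (r.num : ℝ) / r.den := by linarith
      rw [le_div_iff₀ hqpos] at h1
      linarith
    have hn2 : (r.num : ℝ) ≤ 2 * r.den := by
      have h1 : (r.num : ℝ) / r.den ≤ 2 := by linarith
      rwa [div_le_iff₀ hqpos] at h1
    have hn1' : -(r.den : ℤ) ≤ r.num := by exact_mod_cast hn1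
    have hn2' : r.num ≤ 2 * r.den := by exact_mod_cast hn2
    refine ⟨?_, hn1', hn2'⟩
    by_contra hcon
    rw [not_lt, max_le_iff] at hcon
    have hL : s K + 3 ≤ Nat.log 2 r.den := by
      have := Nat.log_mono_right (b := 2) hcon.2
      rwa [Nat.log_pow one_lt_two] at this
    have hex : ¬ IsExceptionalDen s e r.den := by
      intro hex
      have := hQ r.den hcon.1 hex r.num hn1' hn2'
      rw [← Rat.cast_def r] at this
      exact this.not_ge hr8
    obtain ⟨j, hj, hrj⟩ := h.eq_truncation hd hr8 (by omega : s K + 2 < _) hex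
    have hb := truncation_bounds (h.start_lt_end j) (hd _).2.1 (hd _).2.2
    rw [hrj, truncation_den (hd j).1] at hr
    have h1 := (hb.1.trans (le_abs_self _)).trans hr
    push_cast at h1
    rw [← Real.rpow_natCast, ← Real.rpow_natCast, ← Real.rpow_mul (by norm_num),
      ← Real.rpow_neg (by norm_num), Real.rpow_le_rpow_left_iff one_lt_two] at h1
    have h2 := hK j hj
    push_cast at h1 h2
    linarith
  refine hν (Set.Finite.subset ?_ hbound)
  set B := max Q (2 ^ (s K + 3))
  refine Set.Finite.subset (((Finset.Icc (-(B : ℤ)) (2 * B)) ×ˢ Finset.range B).finite_toSet.image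
    fun i : ℤ × ℕ => (i.1 : ℚ) / i.2) fun r hr => ⟨(r.num, r.den), ?_, Rat.num_div_den r⟩
  obtain ⟨h1, h2, h3⟩ := hr
  simp only [Finset.coe_product, Set.mem_prod, Finset.mem_coe, Finset.mem_Icc, Finset.mem_range]
  omega

end IsBlockSequence

end Gaps

/-! ### Almost sure value of the irrationality exponent -/

section FreeCount

theorem sub_le_freeCount {F : Set ℕ} {a m : ℕ} (h : ∀ n, a ≤ n → n < m → n ∈ F) :
    m - a ≤ freeCount F m := by
  classical
  rw [← Nat.card_Ico, freeCount]
  refine Finset.card_le_card fun n hn => ?_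
  rw [Finset.mem_Ico] at hn
  rw [Finset.mem_filter, Finset.mem_range]
  exact ⟨hn.2, h n hn.1 hn.2⟩

theorem le_freeCount_add_freeCount {F G : Set ℕ} (h : ∀ n, n ∈ F ∨ n ∈ G) (m : ℕ) :
    m ≤ freeCount F m + freeCount G m := by
  classical
  unfold freeCount
  refine le_trans (le_of_eq ?_) (Finset.card_union_le _ _)
  rw [← Finset.filter_or, Finset.filter_true_of_mem fun n _ => h n, Finset.card_range]

end FreeCount

/-- The positions outside the blocks `[s k, e k]`. -/
def freeSet (s e : ℕ → ℕ) : Set ℕ := {n | ∀ k, ¬ (s k ≤ n ∧ n ≤ e k)}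

open Classical in
/-- The digit `1` at the ends of the blocks and `0` elsewhere. -/
noncomputable def blockDigits (s e : ℕ → ℕ) (n : ℕ) : Fin 2 :=
  if ∃ k, n = s k ∨ n = e k then 1 else 0

namespace IsBlockSequence

variable {l : ℝ≥0∞} {s e : ℕ → ℕ}

theorem isGapped_prescribeDigits (h : IsBlockSequence l s e) (ω : ℕ → Fin 2) :
    IsGapped s e (prescribeDigits (freeSet s e) (blockDigits s e) ω) := by
  intro k
  have hk := (h.start_lt_end k).le
  have hF : ∀ n, s k ≤ n → n ≤ e k →
      prescribeDigits (freeSet s e) (blockDigits s e) ω n = blockDigits s e n := fun n h1 h2 =>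
    if_neg fun hn => hn k ⟨h1, h2⟩
  refine ⟨?_, ?_, fun n h1 h2 => ?_⟩
  · rw [hF _ le_rfl hk]
    exact if_pos ⟨k, Or.inl rfl⟩
  · rw [hF _ hk le_rfl]
    exact if_pos ⟨k, Or.inr rfl⟩
  · rw [hF _ h1.le h2.le]
    refine if_neg ?_
    rintro ⟨j, rfl | rfl⟩
    · have := h.eq_of_mem le_rfl (h.start_lt_end j).le h1.le h2.le
      subst this
      exact h1.false
    · have := h.eq_of_mem (h.start_lt_end j).le le_rfl h1.le h2.le
      subst this
      exact h2.false

theorem mem_freeSet (h : IsBlockSequence l s e) {j n : ℕ} (h1 : e j < n) (h2 : n < s (j + 1)) :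
    n ∈ freeSet s e := by
  rintro k ⟨hk, hk'⟩
  rcases le_or_gt k j with hkj | hjk
  · have : e k ≤ e j := by
      rcases hkj.eq_or_lt with rfl | hlt
      · exact le_rfl
      · exact ((h.end_lt_start hlt).trans (h.start_lt_end j)).le
    omega
  · have := h.strictMono_start.monotone (Nat.succ_le_of_lt hjk)
    simp only [Nat.succ_eq_add_one] at this
    omega

/-- Put `L = Nat.log 2 q`. As `e j` is at least `8 * (s j + 1)` and at most `s j + L + 2`, the start
`s j` is below `L / 7` and `e j ≤ 2 * L + 2`. All positions after `e j` and below `7 * L - 2 ≤ s (j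
+ 1)` are free. -/
theorem le_freeCount_of_isExceptionalDen (h : IsBlockSequence l s e) {q : ℕ}
    (hq : IsExceptionalDen s e q) :
    5 * Nat.log 2 q - 5 ≤ freeCount (freeSet s e) (7 * Nat.log 2 q - 2) := by
  obtain ⟨j, h1, h2⟩ := hq
  have h3 := h.eight_mul_le j
  have h4 := sub_le_freeCount (F := freeSet s e) (a := e j + 1) (m := 7 * Nat.log 2 q - 2)
    fun n hn hn' => h.mem_freeSet hn (by omega)
  omega

theorem coinMeasure_approx_le (h : IsBlockSequence l s e) {q : ℕ} (hq : IsExceptionalDen s e q)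
    (hq0 : q ≠ 0) (x : ℝ) :
    coinMeasure {ω | |randomReal (freeSet s e) (blockDigits s e) ω - x| ≤
      (2 ^ (8 * Nat.log 2 q))⁻¹} ≤ ENNReal.ofReal (2 ^ 12 / q ^ 5) := by
  set L := Nat.log 2 q with hL
  have hq1 : (0 : ℝ) < q := by positivity
  have hqL : (q : ℝ) < 2 ^ (L + 1) := by exact_mod_cast Nat.lt_pow_succ_log_self one_lt_two q
  calc _ ≤ coinMeasure {ω | |randomReal (freeSet s e) (blockDigits s e) ω - x| ≤
        (2 ^ (7 * L - 2))⁻¹} := by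
        refine measure_mono fun ω hω => Set.mem_ofPred.2 (le_trans hω ?_)
        gcongr
        · norm_num
        · omega
    _ ≤ 4 * 2⁻¹ ^ freeCount (freeSet s e) (7 * L - 2) := coinMeasure_abs_sub_le _ _ _ _
    _ ≤ 4 * 2⁻¹ ^ (5 * L - 5) := by
        gcongr 4 * ?_
        exact pow_le_pow_right_of_le_one' (by simp) (h.le_freeCount_of_isExceptionalDen hq)
    _ = ENNReal.ofReal (4 * (2 ^ (5 * L - 5))⁻¹) := by
        rw [ENNReal.ofReal_mul (by norm_num), ENNReal.ofReal_inv_of_pos (by positivity),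
          ENNReal.ofReal_pow (by norm_num), ENNReal.inv_pow]
        simp
    _ ≤ _ := by
        refine ENNReal.ofReal_le_ofReal ?_
        have h1 : (q : ℝ) ^ 5 ≤ 2 ^ 10 * 2 ^ (5 * L - 5) := by
          calc (q : ℝ) ^ 5 ≤ (2 ^ (L + 1)) ^ 5 := by gcongr
            _ = 2 ^ (5 * L + 5) := by rw [← pow_mul]; ring_nf
            -- An inequality, because `5 * L - 5` is truncated at `L = 0`. The factor `2 ^ 10` here
            -- and the `4` above make up `2 ^ 12`.
            _ ≤ 2 ^ (10 + (5 * L - 5)) := pow_le_pow_right₀ one_le_two (by omega)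
            _ = _ := pow_add _ _ _
        rw [← div_eq_mul_inv, div_le_div_iff₀ (by positivity) (by positivity)]
        linarith

/-- Borel–Cantelli over exceptional denominators: `3 * q + 1` numerators, each of probability `O(q ^
(-5))`, give a summable bound. -/
theorem ae_irrationalityExponent_eq (h : IsBlockSequence l s e) (hl : 8 ≤ l) :
    ∀ᵐ ω ∂coinMeasure,
      irrationalityExponent (randomReal (freeSet s e) (blockDigits s e) ω) = l := by
  set X := randomReal (freeSet s e) (blockDigits s e)
  set B : ℕ → Set (ℕ → Fin 2) := fun q => {ω | q ≠ 0 ∧ IsExceptionalDen s e q ∧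
    ∃ p ∈ Finset.Icc (-(q : ℤ)) (2 * q), |X ω - p / q| ≤ (2 ^ (8 * Nat.log 2 q))⁻¹} with hB
  have hBq : ∀ q, coinMeasure (B q) ≤ ENNReal.ofReal (2 ^ 14 * (1 / (q : ℝ) ^ 2)) := by
    intro q
    by_cases hq : q ≠ 0 ∧ IsExceptionalDen s e q
    swap
    · have : B q = ∅ := Set.eq_empty_of_forall_notMem fun ω hω => hq ⟨hω.1, hω.2.1⟩
      simp [this]
    have hsub : B q ⊆ ⋃ p ∈ Finset.Icc (-(q : ℤ)) (2 * q),
        {ω | |X ω - p / q| ≤ (2 ^ (8 * Nat.log 2 q))⁻¹} := by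
      rintro ω ⟨-, -, p, hp, hω⟩
      exact Set.mem_iUnion₂.2 ⟨p, hp, hω⟩
    have hq1 : (1 : ℝ) ≤ q := by exact_mod_cast Nat.one_le_iff_ne_zero.2 hq.1
    have hcard : (Finset.Icc (-(q : ℤ)) (2 * q)).card = 3 * q + 1 := by
      rw [Int.card_Icc]
      omega
    calc coinMeasure (B q) ≤ ∑ p ∈ Finset.Icc (-(q : ℤ)) (2 * q),
          coinMeasure {ω | |X ω - p / q| ≤ (2 ^ (8 * Nat.log 2 q))⁻¹} :=
          (measure_mono hsub).trans (measure_biUnion_finset_le _ _)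
      _ ≤ ∑ _p ∈ Finset.Icc (-(q : ℤ)) (2 * q), ENNReal.ofReal (2 ^ 12 / q ^ 5) :=
          Finset.sum_le_sum fun p _ => h.coinMeasure_approx_le hq.2 hq.1 _
      _ = ENNReal.ofReal ((3 * q + 1) * (2 ^ 12 / q ^ 5)) := by
          rw [Finset.sum_const, hcard, nsmul_eq_mul, ← ENNReal.ofReal_natCast,
            ← ENNReal.ofReal_mul (by positivity)]
          push_cast
          rfl
      _ ≤ _ := by
          refine ENNReal.ofReal_le_ofReal ?_
          rw [mul_one_div, mul_div_assoc', div_le_div_iff₀ (by positivity) (by positivity)]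
          have h1 : (q : ℝ) ^ 3 ≤ q ^ 5 := pow_le_pow_right₀ hq1 (by norm_num)
          have h2 : (q : ℝ) ^ 2 ≤ q ^ 5 := pow_le_pow_right₀ hq1 (by norm_num)
          nlinarith
  have hsum : Summable fun q : ℕ => (2 : ℝ) ^ 14 * (1 / (q : ℝ) ^ 2) :=
    (Real.summable_one_div_nat_pow.2 one_lt_two).mul_left _
  filter_upwards [ae_eventually_notMem
    (ne_top_of_le_ne_top hsum.tsum_ofReal_ne_top (ENNReal.tsum_le_tsum hBq))] with ω hω
  have hd := h.isGapped_prescribeDigits ω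
  refine le_antisymm (h.irrationalityExponent_le hl hd ?_) (h.le_irrationalityExponent hd)
  filter_upwards [hω, eventually_ne_atTop 0] with q hq hq0 hex p hp1 hp2
  by_contra hcon
  exact hq ⟨hq0, hex, p, Finset.mem_Icc.2 ⟨hp1, hp2⟩, not_lt.1 hcon⟩

end IsBlockSequence

/-! ### Construction of the interleaved blocks -/

section Construction

/-- The end of the `k`-th block if it starts at `a`. -/
noncomputable def blockEnd (l : ℝ≥0∞) (k a : ℕ) : ℕ :=
  ⌈(min l (k + 8 : ℕ)).toReal * (a + 1 : ℕ)⌉₊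

theorem eight_mul_le_blockEnd {l : ℝ≥0∞} (hl : 8 ≤ l) (k a : ℕ) : 8 * (a + 1) ≤ blockEnd l k a := by
  have hne : min l (k + 8 : ℕ) ≠ ∞ := ((min_le_right _ _).trans_lt (ENNReal.natCast_lt_top _)).ne
  have h8 : (8 : ℝ) ≤ (min l (k + 8 : ℕ)).toReal := by
    rw [← ENNReal.toReal_ofNat 8, ENNReal.toReal_le_toReal (by simp) hne]
    refine le_min hl ?_
    push_cast
    exact le_add_self
  have h : ((8 * (a + 1) : ℕ) : ℝ) ≤ blockEnd l k a := by
    refine le_trans ?_ (Nat.le_ceil _)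
    rw [Nat.cast_mul]
    exact mul_le_mul_of_nonneg_right h8 (by positivity)
  exact_mod_cast h

/-- The cap `k + 8` in `blockEnd` makes the ratio finite when `l = ∞`, never goes below `8`, and
tends to infinity, so the ratios still converge to `l`. -/
theorem isBlockSequence_of_eq_blockEnd {l : ℝ≥0∞} (hl : 8 ≤ l) {s e : ℕ → ℕ}
    (hlt : ∀ k, e k < s (k + 1)) (he : ∀ k, e k = blockEnd l k (s k)) :
    IsBlockSequence l s e := by
  have h8 : ∀ k, 8 * (s k + 1) ≤ e k := fun k => by
    rw [he]
    exact eight_mul_le_blockEnd hl k (s k)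
  have hmono : StrictMono s := strictMono_nat_of_lt_succ fun k => by
    have := h8 k
    have := hlt k
    omega
  have hne : ∀ k : ℕ, min l (k + 8 : ℕ) ≠ ∞ := fun k =>
    ((min_le_right _ _).trans_lt (ENNReal.natCast_lt_top _)).ne
  refine ⟨hlt, h8, fun ν hν => ?_, fun ν hν => ?_⟩
  · obtain ⟨K, hK⟩ := exists_nat_ge (ν : ℝ)
    filter_upwards [eventually_ge_atTop K] with k hk
    rw [he]
    refine le_trans ?_ (Nat.le_ceil _)
    gcongr
    rw [← ENNReal.coe_toReal, ENNReal.toReal_le_toReal (by simp) (hne k)]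
    refine le_min hν.le ?_
    have h1 : (ν : ℝ) ≤ (k + 8 : ℕ) := by
      refine hK.trans ?_
      exact_mod_cast (by omega : K ≤ k + 8)
    have h2 : ν ≤ ((k + 8 : ℕ) : ℝ≥0) := by exact_mod_cast h1
    exact_mod_cast h2
  · have hl' : l ≠ ∞ := (hν.trans ENNReal.coe_lt_top).ne
    have hlν : l.toReal < ν := by
      rw [← ENNReal.coe_toReal, ENNReal.toReal_lt_toReal hl' (by simp)]
      exact hν
    obtain ⟨K, hK⟩ := exists_nat_ge (2 / (ν - l.toReal))
    rw [div_le_iff₀ (by linarith)] at hK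
    filter_upwards [eventually_ge_atTop K] with k hk
    have h1 : (e k : ℝ) < l.toReal * (s k + 1 : ℕ) + 1 := by
      rw [he]
      refine (Nat.ceil_lt_add_one (by positivity)).trans_le ?_
      gcongr
      exact min_le_left _ _
    have h2 : (K : ℝ) ≤ (s k + 1 : ℕ) := by
      have := hmono.le_apply (x := k)
      exact_mod_cast (by omega : K ≤ s k + 1)
    nlinarith

/-- The starts of the blocks for the first coordinate. -/
noncomputable def firstStart (l₀ l₁ : ℝ≥0∞) : ℕ → ℕ
  | 0 => 0
  | k + 1 => (k + 1) * (blockEnd l₁ k (blockEnd l₀ k (firstStart l₀ l₁ k) + 1) + 1)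

/-- Two block sequences with disjoint blocks, such that at suitable scales the proportion of the
positions below that scale that belong to a block is arbitrarily small. -/
theorem exists_isBlockSequence_pair {l₀ l₁ : ℝ≥0∞} (h₀ : 8 ≤ l₀) (h₁ : 8 ≤ l₁) :
    ∃ s₀ e₀ s₁ e₁ : ℕ → ℕ, IsBlockSequence l₀ s₀ e₀ ∧ IsBlockSequence l₁ s₁ e₁ ∧
      (∀ n, n ∈ freeSet s₀ e₀ ∨ n ∈ freeSet s₁ e₁) ∧
      ∀ k : ℕ, ∃ t, 0 < t ∧
        k * t ≤ freeCount (freeSet s₀ e₀) ((k + 1) * t) ∧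
        k * t ≤ freeCount (freeSet s₁ e₁) ((k + 1) * t) := by
  set s₀ := firstStart l₀ l₁
  set e₀ : ℕ → ℕ := fun k => blockEnd l₀ k (s₀ k) with he₀
  set s₁ : ℕ → ℕ := fun k => e₀ k + 1 with hs₁
  set e₁ : ℕ → ℕ := fun k => blockEnd l₁ k (s₁ k) with he₁
  have hstep : ∀ k, s₀ (k + 1) = (k + 1) * (e₁ k + 1) := fun k => rfl
  have hse₁ : ∀ k, s₁ k < e₁ k := fun k => by
    have := eight_mul_le_blockEnd h₁ k (s₁ k)
    simp only [he₁]
    omega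
  have hse₀ : ∀ k, s₀ k < e₀ k := fun k => by
    have := eight_mul_le_blockEnd h₀ k (s₀ k)
    simp only [he₀]
    omega
  have hes : ∀ k, e₁ k < s₀ (k + 1) := fun k => by
    rw [hstep]
    nlinarith
  have hes₀ : ∀ k, e₀ k < s₀ (k + 1) := fun k => by
    have h1 := hse₁ k
    have h2 := hes k
    simp only [hs₁] at h1
    omega
  have hes₁ : ∀ k, e₁ k < s₁ (k + 1) := fun k => by
    have h1 := hes k
    have h2 := hse₀ (k + 1)
    simp only [hs₁]
    omega
  have H₀ := isBlockSequence_of_eq_blockEnd h₀ hes₀ fun _ => rfl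
  have H₁ := isBlockSequence_of_eq_blockEnd h₁ hes₁ fun _ => rfl
  -- With `t = e₁ k + 1`, the next block starts at `s₀ (k + 1) = (k + 1) * t`, so all positions from
  -- `t` up to there are free in both coordinates. Disjointness follows from the order `s₀ k < e₀ k
  -- < s₁ k < e₁ k < s₀ (k + 1)`.
  refine ⟨s₀, e₀, s₁, e₁, H₀, H₁, fun n => ?_, fun k => ⟨e₁ k + 1, by omega, ?_, ?_⟩⟩
  · by_contra hcon
    simp only [freeSet, Set.mem_ofPred, not_or, not_forall, not_not] at hcon
    obtain ⟨⟨i, hi, hi'⟩, j, hj, hj'⟩ := hcon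
    rcases le_or_gt i j with hij | hji
    · have h1 := H₁.strictMono_start.monotone hij
      have h2 : s₁ i = e₀ i + 1 := rfl
      omega
    · have h1 := H₀.strictMono_start.monotone (Nat.succ_le_of_lt hji)
      have h2 := hes j
      simp only [Nat.succ_eq_add_one] at h1
      omega
  · have h := sub_le_freeCount (F := freeSet s₀ e₀) (a := e₁ k + 1) (m := s₀ (k + 1))
      fun n hn hn' => H₀.mem_freeSet (j := k)
        (by have h1 := hse₁ k; simp only [hs₁] at h1; omega) hn'
    rw [hstep] at h
    refine le_trans (le_of_eq ?_) h
    rw [Nat.succ_mul, Nat.add_sub_cancel]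
  · have h := sub_le_freeCount (F := freeSet s₁ e₁) (a := e₁ k + 1) (m := s₀ (k + 1))
      fun n hn hn' => H₁.mem_freeSet (j := k) (by omega)
        (by have h1 := hse₀ (k + 1); simp only [hs₁]; omega)
    rw [hstep] at h
    refine le_trans (le_of_eq ?_) h
    rw [Nat.succ_mul, Nat.add_sub_cancel]

end Construction

/-! ### From ball estimates to dimensions -/

section MassDistribution

theorem ofReal_inv_two_pow (m : ℕ) : ENNReal.ofReal (2 ^ m)⁻¹ = 2⁻¹ ^ m := by
  rw [ENNReal.ofReal_inv_of_pos (by positivity), ENNReal.ofReal_pow two_pos.le,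
    ENNReal.inv_pow, ENNReal.ofReal_ofNat]

variable {X : Type*} [MetricSpace X] [MeasurableSpace X] (μ : Measure X) {A : Set X}

/-- Mass distribution principle in dimension one, for dyadic radii. -/
theorem one_le_dimH_of_measure_closedBall_le [BorelSpace X] (hA : μ A ≠ 0) {C : ℝ≥0∞}
    (hC0 : C ≠ 0) (hC : C ≠ ∞) (hμ : ∀ x, ∀ m : ℕ, μ (closedBall x (2 ^ m)⁻¹) ≤ C * 2⁻¹ ^ m) :
    1 ≤ dimH A := by
  have hball : ∀ s : Set X, ∀ m : ℕ, ediam s ≤ 2⁻¹ ^ m → μ s ≤ C * 2⁻¹ ^ m := by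
    intro s m hs
    rcases s.eq_empty_or_nonempty with rfl | ⟨x, hx⟩
    · simp
    refine (measure_mono fun y hy => ?_).trans (hμ x m)
    rw [mem_closedBall, ← ENNReal.ofReal_le_ofReal_iff (by positivity), ofReal_inv_two_pow, ← edist_dist]
    exact (edist_le_ediam_of_mem hy hx).trans hs
  -- Rounding the diameter up to a power of `2` costs the factor `2`; diameter `0` needs a limit
  -- over all `m`.
  have hdiam : ∀ s : Set X, ediam s ≤ 1 → μ s ≤ 2 * C * ediam s := by
    intro s hs
    rcases eq_or_ne (ediam s) 0 with h0 | h0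
    · have hlim : Tendsto (fun m : ℕ => C * (2⁻¹ : ℝ≥0∞) ^ m) atTop (𝓝 0) := by
        have h1 := ENNReal.tendsto_pow_atTop_nhds_zero_of_lt_one
          (r := 2⁻¹) (ENNReal.inv_lt_one.2 ENNReal.one_lt_two)
        simpa using ENNReal.Tendsto.const_mul h1 (Or.inr hC)
      exact (ge_of_tendsto' hlim fun m => hball s m (by simp [h0])).trans bot_le
    · have hex : ∃ m : ℕ, (2⁻¹ : ℝ≥0∞) ^ m < ediam s := by
        obtain ⟨m, hm⟩ := ENNReal.exists_inv_two_pow_lt h0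
        exact ⟨m, hm⟩
      obtain ⟨m, hm, hmin⟩ : ∃ m : ℕ, (2⁻¹ : ℝ≥0∞) ^ m < ediam s ∧
          ∀ i < m, ¬ (2⁻¹ : ℝ≥0∞) ^ i < ediam s :=
        ⟨Nat.find hex, Nat.find_spec hex, fun i hi => Nat.find_min hex hi⟩
      rcases m with _ | m
      · simp only [pow_zero] at hm
        exact absurd hs hm.not_ge
      refine (hball s m (not_lt.1 (hmin m m.lt_succ_self))).trans ?_
      have h2 : (2⁻¹ : ℝ≥0∞) ^ m = 2 * 2⁻¹ ^ (m + 1) := by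
        rw [pow_succ', ← mul_assoc, ENNReal.mul_inv_cancel (by simp) (by simp), one_mul]
      rw [h2, ← mul_assoc, mul_comm C 2]
      gcongr
  have h2C0 : 2 * C ≠ 0 := by simp [hC0]
  have h2C : 2 * C ≠ ∞ := ENNReal.mul_ne_top (by simp) hC
  have hle := Measure.le_hausdorffMeasure 1 ((2 * C)⁻¹ • μ) 1 one_pos fun s hs => by
    rw [ENNReal.rpow_one, Measure.smul_apply, smul_eq_mul]
    calc (2 * C)⁻¹ * μ s ≤ (2 * C)⁻¹ * (2 * C * ediam s) := by
          gcongr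
          exact hdiam s hs
      _ = ediam s := by rw [← mul_assoc, ENNReal.inv_mul_cancel h2C0 h2C, one_mul]
  have hne : μH[((1 : ℝ≥0) : ℝ)] A ≠ 0 := by
    intro h0
    have h1 := hle A
    rw [← NNReal.coe_one, h0, Measure.smul_apply, smul_eq_mul, nonpos_iff_eq_zero, mul_eq_zero] at h1
    exact h1.elim (ENNReal.inv_ne_zero.2 h2C) hA
  exact_mod_cast le_dimH_of_hausdorffMeasure_ne_zero hne

/-- At radius `2 ^ (-(k + 1) * t)` the local mass exponent is `2 * k / (k + 1)` up to a constant
factor, and this exceeds any `s < 2` for large `k`. -/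
theorem two_le_dimPacking_of_measure_closedBall_le [SecondCountableTopology X] (hA : μ A ≠ 0)
    (hμ : ∀ k : ℕ, ∃ t : ℕ, 0 < t ∧ ∀ x,
      μ (closedBall x (2 ^ ((k + 1) * t))⁻¹) ≤ 2 ^ 4 * 2⁻¹ ^ (2 * (k * t))) :
    2 ≤ dimPacking A := by
  refine ENNReal.le_of_forall_nnreal_lt fun s hs => ?_
  have hs2 : (s : ℝ) < 2 := by
    have : s < 2 := by exact_mod_cast hs
    exact_mod_cast this
  refine le_iSup₂_of_le s (packingMeasure_eq_top μ hA fun κ hκ δ hδ => ?_) le_rfl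
  obtain ⟨n, hn⟩ := ENNReal.exists_inv_two_pow_lt hκ
  obtain ⟨a, ha⟩ := exists_pow_lt_of_lt_one hδ (by norm_num : (2⁻¹ : ℝ) < 1)
  -- Since `s < 2` and `t ≥ 1`, `k * (2 - s) ≥ 6 + n` gives `2 * k * t - (k + 1) * t * s ≥ 4 + n`:
  -- the `4` absorbs `2 ^ 4` and `n` absorbs `κ`. The index `a` makes the radius small.
  obtain ⟨b, hb⟩ := exists_nat_ge ((6 + n) / (2 - (s : ℝ)))
  rw [div_le_iff₀ (by linarith)] at hb
  set k := max a b with hk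
  obtain ⟨t, ht, hμt⟩ := hμ k
  set m := (k + 1) * t with hm
  have ht1 : (1 : ℝ) ≤ t := by exact_mod_cast ht
  have hkb : (b : ℝ) ≤ k := by exact_mod_cast le_max_right a b
  have ham : a ≤ m := by
    have : a ≤ k := le_max_left a b
    nlinarith
  have h2r : 2 * ((2 ^ m : ℝ)⁻¹ / 2) = (2 ^ m)⁻¹ := by ring
  refine ⟨(2 ^ m)⁻¹ / 2, by positivity, ?_, fun x => ?_⟩
  · have h1 : (2⁻¹ : ℝ) ^ m ≤ 2⁻¹ ^ a :=
      pow_le_pow_of_le_one (by norm_num) (by norm_num) ham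
    rw [inv_pow] at h1
    have h2 : (0 : ℝ) < (2 ^ m)⁻¹ := by positivity
    linarith
  rw [h2r]
  calc μ (closedBall x (2 ^ m)⁻¹) ≤ 2 ^ 4 * 2⁻¹ ^ (2 * (k * t)) := hμt x
    _ = ENNReal.ofReal (2 ^ (4 - (2 * (k * t) : ℕ) : ℝ)) := by
        rw [Real.rpow_sub two_pos, div_eq_mul_inv, ENNReal.ofReal_mul (by positivity),
          Real.rpow_natCast, ofReal_inv_two_pow, show (4 : ℝ) = ((4 : ℕ) : ℝ) by norm_num,
          Real.rpow_natCast, ENNReal.ofReal_pow two_pos.le, ENNReal.ofReal_ofNat]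
    _ ≤ ENNReal.ofReal (2 ^ (-n : ℝ) * 2 ^ (-(m : ℝ) * s)) := by
        refine ENNReal.ofReal_le_ofReal ?_
        rw [← Real.rpow_add two_pos]
        refine Real.rpow_le_rpow_of_exponent_le one_le_two ?_
        rw [hm]
        push_cast
        nlinarith [mul_le_mul_of_nonneg_right hkb (by linarith : (0 : ℝ) ≤ 2 - s),
          mul_le_mul_of_nonneg_right hkb (by positivity : (0 : ℝ) ≤ t)]
    _ = 2⁻¹ ^ n * ENNReal.ofReal (2 ^ m)⁻¹ ^ (s : ℝ) := by
        rw [ENNReal.ofReal_mul (by positivity), Real.rpow_neg two_pos.le, Real.rpow_natCast,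
          ofReal_inv_two_pow, Real.rpow_mul two_pos.le, Real.rpow_neg two_pos.le,
          Real.rpow_natCast, ← ENNReal.ofReal_rpow_of_nonneg (by positivity) s.coe_nonneg]
    _ ≤ κ * ENNReal.ofReal (2 ^ m)⁻¹ ^ (s : ℝ) := by
        gcongr

end MassDistribution

/-! ### Random points in the plane and the conclusion -/

section Plane

/-- The point of the plane with independent random coordinates. -/
noncomputable def randomPoint (F G : Set ℕ) (c d : ℕ → Fin 2)
    (ω : (ℕ → Fin 2) × (ℕ → Fin 2)) : EuclideanSpace ℝ (Fin 2) :=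
  !₂[randomReal F c ω.1, randomReal G d ω.2]

theorem measurable_randomPoint (F G : Set ℕ) (c d : ℕ → Fin 2) :
    Measurable (randomPoint F G c d) := by
  refine (WithLp.measurable_toLp 2 _).comp (measurable_pi_lambda _ fun i => ?_)
  fin_cases i
  · exact (measurable_randomReal F c).comp measurable_fst
  · exact (measurable_randomReal G d).comp measurable_snd

theorem abs_sub_apply_le_dist (x y : EuclideanSpace ℝ (Fin 2)) (i : Fin 2) :
    |x i - y i| ≤ dist x y := by
  rw [dist_eq_norm]
  exact PiLp.norm_apply_le (x - y) i

theorem map_randomPoint_closedBall_le (F G : Set ℕ) (c d : ℕ → Fin 2)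
    (x : EuclideanSpace ℝ (Fin 2)) (m : ℕ) :
    (coinMeasure.prod coinMeasure).map (randomPoint F G c d) (closedBall x (2 ^ m)⁻¹) ≤
      2 ^ 4 * 2⁻¹ ^ (freeCount F m + freeCount G m) := by
  rw [Measure.map_apply (measurable_randomPoint F G c d) measurableSet_closedBall]
  have hsub : randomPoint F G c d ⁻¹' closedBall x (2 ^ m)⁻¹ ⊆
      {ω | |randomReal F c ω - x 0| ≤ (2 ^ m)⁻¹} ×ˢ
        {ω | |randomReal G d ω - x 1| ≤ (2 ^ m)⁻¹} := fun ω hω =>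
    ⟨(abs_sub_apply_le_dist (randomPoint F G c d ω) x 0).trans hω,
      (abs_sub_apply_le_dist (randomPoint F G c d ω) x 1).trans hω⟩
  refine (measure_mono hsub).trans ?_
  rw [Measure.prod_prod]
  refine (mul_le_mul' (coinMeasure_abs_sub_le F c m _) (coinMeasure_abs_sub_le G d m _)).trans
    (le_of_eq ?_)
  rw [pow_add]
  ring

/-- One measure serves both bounds: the law of a random point with independent coordinates.
Disjointness of the blocks controls every scale, and the long free stretches control the special
ones. -/
theorem one_le_dimH_and_two_le_dimPacking {l₀ l₁ : ℝ≥0∞} (h₀ : 8 ≤ l₀) (h₁ : 8 ≤ l₁) :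
    1 ≤ dimH (planarProduct (exactOrderSet l₀) (exactOrderSet l₁)) ∧
      2 ≤ dimPacking (planarProduct (exactOrderSet l₀) (exactOrderSet l₁)) := by
  obtain ⟨s₀, e₀, s₁, e₁, H₀, H₁, hfree, hscale⟩ := exists_isBlockSequence_pair h₀ h₁
  set F := freeSet s₀ e₀
  set G := freeSet s₁ e₁
  set f := randomPoint F G (blockDigits s₀ e₀) (blockDigits s₁ e₁)
  set μ := (coinMeasure.prod coinMeasure).map f
  have hA : μ (planarProduct (exactOrderSet l₀) (exactOrderSet l₁)) ≠ 0 := by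
    intro hzero
    -- Only the inequality `le_map_apply` is used, so the product set need not be shown measurable.
    have h1 : coinMeasure.prod coinMeasure
        (f ⁻¹' planarProduct (exactOrderSet l₀) (exactOrderSet l₁)) = 0 :=
      le_antisymm ((Measure.le_map_apply (measurable_randomPoint _ _ _ _).aemeasurable _).trans
        hzero.le) bot_le
    have h2 := Measure.quasiMeasurePreserving_fst.ae
      (μb := coinMeasure) (μa := coinMeasure.prod coinMeasure) (H₀.ae_irrationalityExponent_eq h₀)
    have h3 := Measure.quasiMeasurePreserving_snd.ae
      (μb := coinMeasure) (μa := coinMeasure.prod coinMeasure) (H₁.ae_irrationalityExponent_eq h₁)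
    obtain ⟨ω, hω, hω₀, hω₁⟩ := ((measure_eq_zero_iff_ae_notMem.1 h1).and (h2.and h3)).exists
    exact hω ⟨hω₀, hω₁⟩
  constructor
  · refine one_le_dimH_of_measure_closedBall_le μ hA (C := 2 ^ 4) (by simp) (by simp) fun x m =>
      (map_randomPoint_closedBall_le F G _ _ x m).trans ?_
    gcongr 2 ^ 4 * ?_
    exact pow_le_pow_right_of_le_one' (by simp) (le_freeCount_add_freeCount hfree m)
  · refine two_le_dimPacking_of_measure_closedBall_le μ hA fun k => ?_
    obtain ⟨t, ht, ht₀, ht₁⟩ := hscale k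
    refine ⟨t, ht, fun x => (map_randomPoint_closedBall_le F G _ _ x _).trans ?_⟩
    gcongr 2 ^ 4 * ?_
    exact pow_le_pow_right_of_le_one' (by simp) (by omega)

end Plane

theorem mainTheorem8 :
    Filter.Tendsto
      (fun l : ℝ≥0∞ × ℝ≥0∞ =>
        dimH (planarProduct (exactOrderSet l.1) (exactOrderSet l.2)))
      (Filter.comap (fun l : ℝ≥0∞ × ℝ≥0∞ => min l.1 l.2) (nhds ∞)) (nhds 1) ∧
    Filter.Tendsto
      (fun l : ℝ≥0∞ × ℝ≥0∞ =>
        dimPacking (planarProduct (exactOrderSet l.1) (exactOrderSet l.2)))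
      (Filter.comap (fun l : ℝ≥0∞ × ℝ≥0∞ => min l.1 l.2) (nhds ∞)) (nhds 2) := by
  have hev : ∀ n : ℕ, ∀ᶠ l : ℝ≥0∞ × ℝ≥0∞ in
      Filter.comap (fun l : ℝ≥0∞ × ℝ≥0∞ => min l.1 l.2) (nhds ∞), n < l.1 ∧ n < l.2 := fun n => by
    filter_upwards [tendsto_comap.eventually (lt_mem_nhds (ENNReal.natCast_lt_top n))] with l hl
    exact lt_min_iff.1 hl
  have hlow := (hev 8).mono fun l hl =>
    one_le_dimH_and_two_le_dimPacking (l₀ := l.1) (l₁ := l.2)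
      (by exact_mod_cast hl.1.le) (by exact_mod_cast hl.2.le)
  constructor
  · refine tendsto_order.2 ⟨fun a ha => hlow.mono fun l hl => ha.trans_le hl.1, fun a ha => ?_⟩
    have hlim : Tendsto (fun n : ℕ => 1 + 3 / (n : ℝ≥0∞)) atTop (𝓝 1) := by
      have h1 : Tendsto (fun n : ℕ => (3 : ℝ≥0∞) / n) atTop (𝓝 0) :=
        ENNReal.Tendsto.const_div ENNReal.tendsto_nat_nhds_top (Or.inr (by simp)) |>.trans
          (by simp)
      simpa using h1.const_add 1
    obtain ⟨n, hn, hn0⟩ := ((hlim.eventually (gt_mem_nhds ha)).and (eventually_ne_atTop 0)).exists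
    exact (hev n).mono fun l hl => (dimH_planarProduct_le hn0 hl.1 _).trans_lt hn
  -- The packing dimension is eventually equal to `2`, not merely convergent to it.
  · refine tendsto_const_nhds.congr' (hlow.mono fun l hl => le_antisymm hl.2 ?_)
    refine (dimPacking_le_finrank _).trans (le_of_eq ?_)
    simp
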